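/- Identify a permutation $g \in S_n$ with the $n \times n$ matrix whose $(i,j)$-entry is $1$ if $g(i)=j$ and $0$ otherwise, and for a subgroup $G \le S_n$ let $P(G) = \operatorname{conv}\{g : g \in G\} \subset \mathbb{R}^{n\times n}$ be its permutation polytope. Call $G \le S_n$ a Frobenius group if it has a nontrivial proper subgroup $H$ such that $H \cap xHx^{-1} = \{e\}$ for all $x \in G \setminus H$, and $G$ acts on $\{1,\dots,n\}$ as on the cosets of $H$, that is, transitively and with $H$ as the stabilizer of a point. For an ideal $I \subseteq \mathbb{R}[x_{ij} : 1 \le i,j \le n]$ and $k \ge 1$, a polynomial $f$ is $k$-sos modulo $I$ if $f \equiv \sum_{j=1}^t h_j^2 \pmod I$ for some polynomials $h_1,\dots,h_t$ of degree at most $k$, and the $k$-th theta body is \[ TH_k(I) = \{ x \in \mathbb{R}^{n \times n} : f(x) \ge 0 \text{ for every polynomial } f \text{ of degree at most } 1 \text{ that is } k\text{-sos modulo } I \}. \] The group $G$ is $TH_1$-exact if $TH_1(I) = P(G)$, where $I$ is the ideal of all polynomials vanishing on the vertex set of $P(G)$. Proposition. If $G \le S_n$ is a Frobenius group, then $P(G)$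 is two-level: for every facet-defining inequality $c \cdot x - \alpha \ge 0$ of $P(G)$ there is a real number $\beta$ such that every vertex $v$ of $P(G)$ satisfies $c \cdot v = \alpha$ or $c \cdot v = \beta$. Moreover, $G$ is $TH_1$-exact, i.e. $TH_1(I) = P(G)$. -/

import Mathlib

namespace PermPolytope

/-- A permutation group `G ≤ Sₙ` is a Frobenius group: there is a nontrivial proper subgroup `H`
of `G` (the Frobenius complement) with `H ∩ x H x⁻¹ = {e}` for all `x ∈ G \ H`, and `G` acts on the
`n` points as it acts on the cosets of `H`, i.e. transitively and with `H` as a point stabilizer. -/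
def IsFrobeniusGroup {n : ℕ} (G : Subgroup (Equiv.Perm (Fin n))) : Prop :=
  ∃ H : Subgroup (Equiv.Perm (Fin n)),
    H ≠ ⊥ ∧ H < G ∧
    (∀ x ∈ G, x ∉ H → ∀ h ∈ H, x * h * x⁻¹ ∈ H → h = 1) ∧
    (∀ i j : Fin n, ∃ g ∈ G, g i = j) ∧
    (∃ i : Fin n, ∀ g ∈ G, g ∈ H ↔ g i = i)

/-- The permutation polytope `P(G)`: the convex hull of the permutation matrices of the elements
of `G`, where the `(i, j)` entry of the matrix of `g` is `1` if `g i = j` and `0` otherwise. -/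
def permutationPolytope {n : ℕ} (G : Subgroup (Equiv.Perm (Fin n))) :
    Set (Matrix (Fin n) (Fin n) ℝ) :=
  convexHull ℝ {M | ∃ g ∈ G, M = Matrix.of fun i j => if g i = j then (1 : ℝ) else 0}

section TwoLevel

/-- The inequality `c x - α ≥ 0` defines a facet of the polytope `P`: it is valid on `P`, and the
nonempty face `{x ∈ P | c x = α}` has dimension `dim P - 1`. -/
def IsFacetDefining {E : Type*} [AddCommGroup E] [Module ℝ E] (P : Set E)
    (c : E →ₗ[ℝ] ℝ) (α : ℝ) : Prop :=
  (∀ x ∈ P, 0 ≤ c x - α) ∧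
  {x | x ∈ P ∧ c x = α}.Nonempty ∧
  Module.finrank ℝ (vectorSpan ℝ {x | x ∈ P ∧ c x = α}) + 1 = Module.finrank ℝ (vectorSpan ℝ P)

/-- `P` is two-level: for every facet, all vertices of `P` lie on the facet hyperplane or on one
parallel hyperplane. -/
def IsTwoLevel {E : Type*} [AddCommGroup E] [Module ℝ E] (P : Set E) : Prop :=
  ∀ (c : E →ₗ[ℝ] ℝ) (α : ℝ), IsFacetDefining P c α →
    ∃ β : ℝ, ∀ v ∈ P.extremePoints ℝ, c v = α ∨ c v = β

end TwoLevel

section ThetaBody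

/-- `f` is `k`-sos modulo `I`: `f` is congruent modulo `I` to a sum of squares of polynomials of
degree at most `k`. -/
def IsKSosMod {σ : Type*} (k : ℕ) (I : Ideal (MvPolynomial σ ℝ)) (f : MvPolynomial σ ℝ) : Prop :=
  ∃ (t : ℕ) (h : Fin t → MvPolynomial σ ℝ),
    (∀ j, (h j).totalDegree ≤ k) ∧ f - ∑ j, h j ^ 2 ∈ I

/-- The `k`-th theta body `TH_k(I)`: the points at which every polynomial of degree at most one
that is `k`-sos modulo `I` is nonnegative. -/
def thetaBody {σ : Type*} (k : ℕ) (I : Ideal (MvPolynomial σ ℝ)) : Set (σ → ℝ) :=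
  {x | ∀ f : MvPolynomial σ ℝ, f.totalDegree ≤ 1 → IsKSosMod k I f → 0 ≤ MvPolynomial.eval x f}

/-- The vector of entries of an `n × n` matrix, indexed by pairs `(i, j)`. -/
def entries {n : ℕ} (X : Matrix (Fin n) (Fin n) ℝ) : Fin n × Fin n → ℝ := fun p => X p.1 p.2

/-- `G` is `TH_k`-exact: `TH_k(I) = P(G)`, where `I ⊆ ℝ[x_ij : 1 ≤ i, j ≤ n]` is the vanishing ideal
of the vertex set of `P(G)`. -/
def IsTHExact {n : ℕ} (k : ℕ) (G : Subgroup (Equiv.Perm (Fin n))) : Prop :=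
  thetaBody k (MvPolynomial.vanishingIdeal ℝ
      (entries '' (permutationPolytope G).extremePoints ℝ)) =
    entries '' permutationPolytope G

end ThetaBody

end PermPolytope

/-!
By Frobenius's theorem, the identity and the fixed-point-free elements of a Frobenius group
`G ≤ Sₙ` form a subgroup `N`. It acts sharply transitively on the points, so the permutation
matrices of each coset of `N` add up to the all-ones matrix (`IsSharpKernel.coset_sum`). Since an
element outside `N` fixes exactly one point, counting fixed points of `g⁻¹x` shows that these are
the only linear relations: the affine functions on the vertices of `P(G)` are exactly the functions
on `G` whose sums over the cosets of `N` agree (`IsSharpKernel.exists_linear`). Geometrically, the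
polytope is a free sum of simplices, one for each coset.

A nonnegative function with equal coset sums is a nonnegative combination of indicators of
transversals of the cosets (`exists_transversal_decomposition`), and these indicators are again
linear functions on the vertices, with values `0` and `1`. Both conclusions follow from this
decomposition. On a facet all summands vanish, so the facet functional is proportional to one of the
indicators, hence two-valued (`HasZeroOneDecomposition.isTwoLevel`). Moreover, an indicator equals
its own square on the vertices, so each valid affine inequality is a sum of squares of linear
polynomials modulo the vanishing ideal, and the first theta body lies in the polytope by separation
(`HasZeroOneDecomposition.thetaBody_one`).

Frobenius's theorem (`exists_frobenius_kernel`) is proved with characters. For an irreducible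
character `θ` of the complement `H`, the class function `Ind(θ - θ(1)) + θ(1)` restricts to `θ`,
pairs integrally with the irreducible characters of `G` and has norm one, hence is an irreducible
character of `G` (`exists_eq_blockChar`). It takes its value at the identity on every element
without conjugates in `H`, so these elements act trivially; conversely, the characters of `H`
separate its nontrivial elements from the identity. The character theory needed is read off a
Wedderburn decomposition of the complex group algebra.
-/

namespace PermPolytope

/-! ### Traces of matrices and of multiplication operators -/

/-- A complex matrix of finite order whose trace equals its size is the identity: its eigenvalues
are roots of unity with sum equal to their number, so all of them are `1`. -/
theorem matrix_eq_one_of_trace_eq {d m : ℕ} (hm : m ≠ 0) (X : Matrix (Fin d) (Fin d) ℂ)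
    (hX : X ^ m = 1) (ht : X.trace = d) : X = 1 := by
  have hnorm : ∀ r ∈ X.charpoly.roots, ‖r‖ = 1 := by
    intro r hr
    have h1 : r ∈ spectrum ℂ X :=
      Matrix.mem_spectrum_of_isRoot_charpoly (Polynomial.isRoot_of_mem_roots hr)
    have h2 := spectrum.pow_mem_pow X m h1
    rw [hX] at h2
    have hd : Nonempty (Fin d) := by
      by_contra hne
      rw [not_nonempty_iff] at hne
      have := Matrix.charpoly_natDegree_eq_dim X
      have h3 := Multiset.card_pos_iff_exists_mem.2 ⟨r, hr⟩
      have h4 := Polynomial.card_roots' X.charpoly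
      rw [this] at h4
      simp at h4
      simp at hr
    rw [spectrum.one_eq, Set.mem_singleton_iff] at h2
    exact Complex.norm_eq_one_of_pow_eq_one h2 hm
  have hsplit := IsAlgClosed.splits X.charpoly
  have hcard : Multiset.card X.charpoly.roots = d := by
    rw [← hsplit.natDegree_eq_card_roots, Matrix.charpoly_natDegree_eq_dim, Fintype.card_fin]
  have hsum : X.charpoly.roots.sum = d := by
    rw [← Matrix.trace_eq_sum_roots_charpoly, ht]
  have hre : (X.charpoly.roots.map fun r => 1 - r.re).sum = 0 := by
    rw [Multiset.sum_map_sub]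
    have : (X.charpoly.roots.map fun r => r.re).sum = d := by
      have := congrArg Complex.reAddGroupHom hsum
      rw [map_multiset_sum] at this
      simpa using this
    rw [this]
    simp [hcard]
  have hone : ∀ r ∈ X.charpoly.roots, r = 1 := by
    intro r hr
    have h0 : ∀ x ∈ X.charpoly.roots.map fun r => 1 - r.re, 0 ≤ x := by
      intro x hx
      obtain ⟨s, hs, rfl⟩ := Multiset.mem_map.1 hx
      have := Complex.re_le_norm s
      rw [hnorm s hs] at this
      linarith
    have h1 := (Multiset.all_zero_of_le_zero_le_of_sum_eq_zero h0 hre)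
      (1 - r.re) (Multiset.mem_map.2 ⟨r, hr, rfl⟩)
    have h2 := hnorm r hr
    have h3 : r.re = 1 := by linarith
    have h4 : r.im = 0 := by
      have := Complex.sq_norm r
      rw [h2, Complex.normSq_apply, h3] at this
      nlinarith
    exact Complex.ext h3 h4
  have hchar : X.charpoly = (Polynomial.X - Polynomial.C 1) ^ d := by
    rw [hsplit.eq_prod_roots, X.charpoly_monic.leadingCoeff, Multiset.eq_replicate_of_mem hone,
      hcard]
    simp
  -- Finite order makes `X` semisimple, and `X - 1` is nilpotent.
  have hnil : IsNilpotent (X - 1) := by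
    refine ⟨d, ?_⟩
    have := X.aeval_self_charpoly
    rw [hchar] at this
    simpa using this
  have hss : Module.End.IsSemisimple (Matrix.toLin' X) := by
    refine Module.End.isSemisimple_of_squarefree_aeval_eq_zero
      (p := Polynomial.X ^ m - Polynomial.C (1 : ℂ))
      (Polynomial.separable_X_pow_sub_C (1 : ℂ) (by exact_mod_cast hm) one_ne_zero).squarefree ?_
    simp [← Matrix.toLin'_pow, hX, Module.End.one_eq_id]
  have hss' : Module.End.IsSemisimple (Matrix.toLin' (X - 1)) := by
    have := hss.aeval (Polynomial.X - Polynomial.C (1 : ℂ))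
    simpa [Module.End.one_eq_id] using this
  have := Module.End.eq_zero_of_isNilpotent_isSemisimple
    (hnil.map (Matrix.toLinAlgEquiv' (R := ℂ) (n := Fin d))) hss'
  rw [EmbeddingLike.map_eq_zero_iff] at this
  exact sub_eq_zero.1 this

/-- The trace of left multiplication by `x` on a product of matrix algebras. -/
theorem trace_mulLeft_pi_matrix {m : ℕ} (d : Fin m → ℕ)
    (x : Π i, Matrix (Fin (d i)) (Fin (d i)) ℂ) :
    LinearMap.trace ℂ _ (LinearMap.mulLeft ℂ x) = ∑ i, (d i : ℂ) * (x i).trace := by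
  classical
  rw [LinearMap.trace_eq_matrix_trace ℂ
    (Pi.basis fun i => Matrix.stdBasis ℂ (Fin (d i)) (Fin (d i)))]
  simp only [Matrix.trace, Matrix.diag_apply, LinearMap.toMatrix_apply, Pi.basis_repr,
    Fintype.sum_sigma, Fintype.sum_prod_type]
  refine Finset.sum_congr rfl fun i _ => ?_
  simp [Matrix.stdBasis, Matrix.mul_apply, Finset.mul_sum, Pi.single_apply, ite_apply]

/-- The trace of left multiplication by a group element on the group algebra. -/
theorem trace_mulLeft_single {G : Type*} [Group G] [Fintype G] [DecidableEq G] (g : G) :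
    LinearMap.trace ℂ (MonoidAlgebra ℂ G) (LinearMap.mulLeft ℂ (MonoidAlgebra.single g 1)) =
      if g = 1 then (Fintype.card G : ℂ) else 0 := by
  rw [LinearMap.trace_eq_matrix_trace ℂ (MonoidAlgebra.basis G ℂ)]
  simp only [Matrix.trace, Matrix.diag_apply, LinearMap.toMatrix_apply]
  simp [MonoidAlgebra.basis, MonoidAlgebra.coeffLinearEquiv, Finsupp.single_apply]

/-! ### Characters via the Wedderburn decomposition -/

section Characters

variable {G : Type*} [Group G]

variable {m : ℕ} {d : Fin m → ℕ}
  (e : MonoidAlgebra ℂ G ≃ₐ[ℂ] Π i, Matrix (Fin (d i)) (Fin (d i)) ℂ)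

/-- The representation of `G` on the `i`-th factor of a Wedderburn decomposition of its group
algebra. -/
noncomputable def blockRep (i : Fin m) : Representation ℂ G (Fin (d i) → ℂ) :=
  (Matrix.toLinAlgEquiv' (R := ℂ) (n := Fin (d i)) : _ →* _).comp
    ((Pi.evalMonoidHom (fun i => Matrix (Fin (d i)) (Fin (d i)) ℂ) i).comp
      ((e : _ →* _).comp (MonoidAlgebra.of ℂ G)))

/-- The irreducible character afforded by `blockRep e i`. -/
noncomputable def blockChar (i : Fin m) (g : G) : ℂ := (e (MonoidAlgebra.single g 1) i).trace

theorem character_blockRep (i : Fin m) : (blockRep e i).character = blockChar e i := by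
  ext g
  simp only [Representation.character, blockRep, blockChar]
  exact Matrix.trace_toLin'_eq _

theorem blockChar_one (i : Fin m) : blockChar e i 1 = d i := by
  rw [blockChar, ← MonoidAlgebra.one_def, map_one]
  simp

theorem blockChar_mul_comm (i : Fin m) (g h : G) : blockChar e i (g * h) = blockChar e i (h * g) := by
  simp only [← character_blockRep]
  exact Representation.char_mul_comm _ _ _

/-- The `i`-th component of a central element is scalar, and its trace determines it. -/
theorem central_block [∀ i, NeZero (d i)] (z : MonoidAlgebra ℂ G) (hz : ∀ x, z * x = x * z)
    (i : Fin m) : e z i = ((d i : ℂ)⁻¹ * (e z i).trace) • 1 := by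
  have hcomm : ∀ a b, Commute (Matrix.single a b (1 : ℂ)) (e z i) := by
    intro a b
    have := congrArg e (hz (e.symm (Pi.single i (Matrix.single a b 1))))
    rw [map_mul, map_mul, AlgEquiv.apply_symm_apply] at this
    have := congrFun this i
    simp only [Pi.mul_apply, Pi.single_eq_same] at this
    exact this.symm
  obtain ⟨r, hr⟩ := Matrix.mem_range_scalar_iff_commute_single'.2 hcomm
  have hd : (d i : ℂ) ≠ 0 := by exact_mod_cast NeZero.ne (d i)
  rw [← hr]
  ext a b
  simp [Matrix.scalar_apply, Matrix.trace, Matrix.one_apply, Matrix.diagonal_apply, hd]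

variable [Fintype G]

/-- The bilinear pairing `|G|⁻¹ ∑ f(x) g(x⁻¹)` on complex functions on a finite group. On characters
it is the usual Hermitian inner product, but no complex conjugation is involved. -/
noncomputable def cfInner (f g : G → ℂ) : ℂ := (Nat.card G : ℂ)⁻¹ * ∑ x, f x * g x⁻¹

theorem cfInner_comm (f g : G → ℂ) : cfInner f g = cfInner g f := by
  unfold cfInner
  congr 1
  rw [← Equiv.sum_comp (Equiv.inv G)]
  simp [mul_comm]

theorem cfInner_add_left (f f' g : G → ℂ) : cfInner (f + f') g = cfInner f g + cfInner f' g := by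
  simp [cfInner, add_mul, Finset.sum_add_distrib, mul_add]

theorem cfInner_smul_left (c : ℂ) (f g : G → ℂ) : cfInner (c • f) g = c * cfInner f g := by
  simp [cfInner, mul_assoc, ← Finset.mul_sum, mul_left_comm]

theorem cfInner_sum_left {ι : Type*} (s : Finset ι) (f : ι → G → ℂ) (g : G → ℂ) :
    cfInner (∑ i ∈ s, f i) g = ∑ i ∈ s, cfInner (f i) g := by
  simp only [cfInner, Finset.sum_apply, Finset.sum_mul, ← Finset.mul_sum]
  rw [Finset.sum_comm]

theorem cfInner_one_one : cfInner (1 : G → ℂ) 1 = 1 := by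
  simp [cfInner]

/-- The pairing of two characters is an integer, being the dimension of a space of intertwining
maps. -/
theorem exists_int_cfInner_character {V W : Type*} [AddCommGroup V] [Module ℂ V]
    [FiniteDimensional ℂ V] [AddCommGroup W] [Module ℂ W] [FiniteDimensional ℂ W]
    (ρ : Representation ℂ G V) (σ : Representation ℂ G W) :
    ∃ z : ℤ, cfInner ρ.character σ.character = z := by
  have : Invertible (Nat.card G : ℂ) := invertibleOfNonzero (by simp)
  exact ⟨Module.finrank ℂ (Representation.IntertwiningMap σ ρ), by
    rw [cfInner, Representation.card_inv_mul_sum_char_mul_char_eq_finrank]; simp⟩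

/-- The character of the regular representation. -/
theorem sum_mul_blockChar [DecidableEq G] (g : G) :
    ∑ i, (d i : ℂ) * blockChar e i g = if g = 1 then (Fintype.card G : ℂ) else 0 := by
  rw [← trace_mulLeft_single, ← LinearMap.trace_conj' _ e.toLinearEquiv]
  simp only [blockChar]
  rw [← trace_mulLeft_pi_matrix]
  congr 1
  refine LinearMap.ext fun x => ?_
  simp only [LinearEquiv.conj_apply, LinearMap.comp_apply, LinearMap.mulLeft_apply]
  exact ((map_mul e _ _).trans (congrArg _ (e.apply_symm_apply x))).symm

/-- Irreducible characters span the class functions: every class function is the sum of its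
components along the irreducible characters. -/
theorem eq_sum_cfInner_smul_blockChar [∀ i, NeZero (d i)] (ψ : G → ℂ)
    (hψ : ∀ g x, ψ (x * g * x⁻¹) = ψ g) :
    ψ = ∑ i, cfInner ψ (blockChar e i) • blockChar e i := by
  classical
  have hψ' : ∀ x y, ψ (x * y) = ψ (y * x) := fun x y => by
    rw [← hψ (x * y) y]; congr 1; group
  -- The central element attached to `ψ` acts as a scalar on each block. Taking the trace of
  -- multiplication by `z * g` on the group algebra recovers `ψ g`.
  let z : MonoidAlgebra ℂ G := ∑ x, MonoidAlgebra.single x (ψ x⁻¹)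
  have hz : ∀ x, z * x = x * z := by
    intro x
    induction x using MonoidAlgebra.induction_linear with
    | zero => simp
    | add x y hx hy => rw [mul_add, add_mul, hx, hy]
    | single g r =>
      simp only [z, Finset.sum_mul, Finset.mul_sum, MonoidAlgebra.single_mul_single]
      rw [← Equiv.sum_comp (Equiv.mulRight g⁻¹), ← Equiv.sum_comp (Equiv.mulLeft g⁻¹)
        (fun x => MonoidAlgebra.single (g * x) (r * ψ x⁻¹))]
      refine Finset.sum_congr rfl fun x _ => ?_
      simp [hψ', mul_comm]
  have hcard : (Nat.card G : ℂ) ≠ 0 := by simp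
  have htr : ∀ i, (e z i).trace = Nat.card G * cfInner ψ (blockChar e i) := by
    intro i
    rw [cfInner_comm, cfInner, mul_inv_cancel_left₀ hcard]
    simp only [z, map_sum, Finset.sum_apply, Matrix.trace_sum, blockChar]
    refine Finset.sum_congr rfl fun x _ => ?_
    have : MonoidAlgebra.single x (ψ x⁻¹) = ψ x⁻¹ • MonoidAlgebra.single x (1 : ℂ) := by simp
    rw [this, map_smul, Pi.smul_apply, Matrix.trace_smul, smul_eq_mul, mul_comm]
  ext g
  have h1 : ∑ i, (d i : ℂ) * (e (z * MonoidAlgebra.single g 1) i).trace = Nat.card G * ψ g := by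
    simp only [z, Finset.sum_mul, MonoidAlgebra.single_mul_single, mul_one, map_sum,
      Finset.sum_apply, Matrix.trace_sum, Finset.mul_sum]
    rw [Finset.sum_comm]
    have : ∀ x, ∑ i, (d i : ℂ) * (e (MonoidAlgebra.single (x * g) (ψ x⁻¹)) i).trace =
        ψ x⁻¹ * if x * g = 1 then (Fintype.card G : ℂ) else 0 := by
      intro x
      rw [← sum_mul_blockChar e, Finset.mul_sum]
      refine Finset.sum_congr rfl fun i _ => ?_
      have : MonoidAlgebra.single (x * g) (ψ x⁻¹) =
        ψ x⁻¹ • MonoidAlgebra.single (x * g) (1 : ℂ) := by simp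
      rw [this, map_smul, Pi.smul_apply, Matrix.trace_smul, smul_eq_mul, blockChar]
      ring
    simp only [this, mul_eq_one_iff_eq_inv]
    simp [mul_comm]
  have h2 : ∀ i, (d i : ℂ) * (e (z * MonoidAlgebra.single g 1) i).trace =
      Nat.card G * (cfInner ψ (blockChar e i) * blockChar e i g) := by
    intro i
    have hd : (d i : ℂ) ≠ 0 := by exact_mod_cast NeZero.ne (d i)
    rw [map_mul, Pi.mul_apply, central_block e z hz i, htr, smul_mul_assoc, one_mul,
      Matrix.trace_smul, smul_eq_mul, blockChar]
    field_simp
  rw [Finset.sum_congr rfl fun i _ => h2 i, ← Finset.mul_sum] at h1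
  rw [← mul_left_cancel₀ hcard h1]
  simp

/-- Irreducible characters have norm one. -/
theorem cfInner_blockChar_self [∀ i, NeZero (d i)] (j : Fin m) :
    cfInner (blockChar e j) (blockChar e j) = 1 := by
  have h := eq_sum_cfInner_smul_blockChar e (blockChar e j) fun g x => by
    rw [blockChar_mul_comm, inv_mul_cancel_left]
  -- The expansion of `blockChar e j` extends linearly to the group algebra, where it is evaluated
  -- at a matrix unit of the `j`-th block.
  have hlin : ∀ a : MonoidAlgebra ℂ G, (e a j).trace =
      ∑ i, cfInner (blockChar e j) (blockChar e i) * (e a i).trace := by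
    intro a
    induction a using MonoidAlgebra.induction_linear with
    | zero => simp
    | add x y hx hy => simp [hx, hy, mul_add, Finset.sum_add_distrib]
    | single g r =>
      have hr : MonoidAlgebra.single g r = r • MonoidAlgebra.single g (1 : ℂ) := by simp
      have := congrFun h g
      simp only [Finset.sum_apply, Pi.smul_apply, smul_eq_mul] at this
      simp only [hr, map_smul, Pi.smul_apply, Matrix.trace_smul, smul_eq_mul]
      change r * blockChar e j g = ∑ i, _ * (r * blockChar e i g)
      rw [this, Finset.mul_sum]
      exact Finset.sum_congr rfl fun i _ => by ring
  have := hlin (e.symm (Pi.single j (Matrix.single 0 0 1)))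
  rw [AlgEquiv.apply_symm_apply, Finset.sum_eq_single j] at this
  · simpa using this.symm
  · intro i _ hij
    simp [Pi.single_eq_of_ne hij]
  · simp

/-- A class function whose pairings with the irreducible characters are integers, which has norm
one and is nonnegative at the identity, is an irreducible character: its squared coordinates are
integers with sum one. -/
theorem exists_eq_blockChar [∀ i, NeZero (d i)] (ψ : G → ℂ)
    (hψ : ∀ g x, ψ (x * g * x⁻¹) = ψ g) (hint : ∀ i, ∃ z : ℤ, cfInner ψ (blockChar e i) = z)
    (hnorm : cfInner ψ ψ = 1) {k : ℕ} (hk : ψ 1 = k) : ∃ i, ψ = blockChar e i := by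
  choose z hz using hint
  have hexp := eq_sum_cfInner_smul_blockChar e ψ hψ
  simp only [hz] at hexp
  have hsq : ∑ i, z i ^ 2 = 1 := by
    have : cfInner ψ ψ = ∑ i, (z i : ℂ) ^ 2 := by
      conv_lhs => enter [1]; rw [hexp]
      rw [cfInner_sum_left]
      refine Finset.sum_congr rfl fun i _ => ?_
      rw [cfInner_smul_left, cfInner_comm, hz, sq]
    rw [hnorm] at this
    exact_mod_cast this.symm
  obtain ⟨i, hi⟩ : ∃ i, z i ≠ 0 := by
    by_contra! h
    simp [h] at hsq
  have hone : 1 ≤ z i ^ 2 := by have := sq_pos_of_ne_zero hi; omega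
  have hrest : ∀ j, j ≠ i → z j = 0 := by
    intro j hj
    have h1 := Finset.add_sum_erase Finset.univ (fun i => z i ^ 2) (Finset.mem_univ i)
    have h2 := Finset.single_le_sum (f := fun i => z i ^ 2) (fun i _ => sq_nonneg (z i))
      (Finset.mem_erase.2 ⟨hj, Finset.mem_univ j⟩)
    have : z j ^ 2 = 0 := le_antisymm (by linarith) (sq_nonneg _)
    exact pow_eq_zero_iff two_ne_zero |>.1 this
  have heq : ψ = (z i : ℂ) • blockChar e i := by
    rw [hexp, Finset.sum_eq_single i]
    · intro j _ hj; simp [hrest j hj]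
    · simp
  have hle : z i ^ 2 = 1 := by
    rw [← hsq, Finset.sum_eq_single i]
    · intro j _ hj; simp [hrest j hj]
    · simp
  rcases mul_self_eq_one_iff.1 ((sq (z i)).symm.trans hle) with h | h
  · exact ⟨i, by rw [heq, h]; simp⟩
  · -- A negative multiple of a character is negative at the identity.
    have h1 := congrFun heq 1
    rw [Pi.smul_apply, blockChar_one, h, hk] at h1
    have h2 : (k : ℤ) + d i = 0 := by
      have : (k : ℂ) + d i = 0 := by rw [h1]; simp
      exact_mod_cast this
    have := NeZero.pos (d i)
    omega

end Characters

/-! ### Frobenius's theorem -/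

section FrobeniusKernel

variable {G : Type*} [Group G] [Fintype G] (H : Subgroup G)

open Classical in
/-- The function on `G` induced from a function `φ` on the subgroup `H`: extend `φ` by zero and
average over conjugation, normalised by `|H|⁻¹`. -/
noncomputable def inducedFun (φ : H → ℂ) (g : G) : ℂ :=
  (Nat.card H : ℂ)⁻¹ * ∑ x : G, if h : x⁻¹ * g * x ∈ H then φ ⟨_, h⟩ else 0

theorem inducedFun_conj (φ : H → ℂ) (g y : G) :
    inducedFun H φ (y * g * y⁻¹) = inducedFun H φ g := by
  classical
  unfold inducedFun
  congr 1
  rw [← Equiv.sum_comp (Equiv.mulLeft y)]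
  refine Finset.sum_congr rfl fun x _ => ?_
  have : (Equiv.mulLeft y x)⁻¹ * (y * g * y⁻¹) * Equiv.mulLeft y x = x⁻¹ * g * x := by
    simp only [Equiv.coe_mulLeft]; group
  simp only [this]

/-- An element with no conjugate in `H` is sent to zero by every induced function. -/
theorem inducedFun_eq_zero (φ : H → ℂ) (g : G) (hg : ∀ x, x * g * x⁻¹ ∉ H) :
    inducedFun H φ g = 0 := by
  classical
  rw [inducedFun, Finset.sum_eq_zero, mul_zero]
  intro x _
  rw [dif_neg]
  simpa using hg x⁻¹

/-- Frobenius reciprocity for class functions. -/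
theorem cfInner_inducedFun [Fintype H] (φ : H → ℂ) (χ : G → ℂ) (hχ : ∀ g x, χ (x * g * x⁻¹) = χ g) :
    cfInner (inducedFun H φ) χ = cfInner φ (fun h => χ h) := by
  classical
  have key : ∀ x : G, ∑ g : G, (if h : x⁻¹ * g * x ∈ H then φ ⟨_, h⟩ else 0) * χ g⁻¹ =
      ∑ h : H, φ h * χ h⁻¹ := by
    intro x
    rw [← Equiv.sum_comp (MulAut.conj x).toEquiv]
    have h1 : ∀ g : G, (if h : x⁻¹ * (MulAut.conj x).toEquiv g * x ∈ H then
        φ ⟨x⁻¹ * (MulAut.conj x).toEquiv g * x, h⟩ else 0) * χ ((MulAut.conj x).toEquiv g)⁻¹ =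
        if h : g ∈ H then φ ⟨g, h⟩ * χ g⁻¹ else 0 := by
      intro g
      have e1 : x⁻¹ * (MulAut.conj x).toEquiv g * x = g := by
        simp [mul_assoc]
      have e2 : χ ((MulAut.conj x).toEquiv g)⁻¹ = χ g⁻¹ := by
        rw [← hχ g⁻¹ x]; congr 1; simp [mul_assoc]
      rw [e2]
      simp only [e1]
      split_ifs <;> simp
    rw [Finset.sum_congr rfl fun g _ => h1 g]
    rw [← Finset.sum_subset (Finset.subset_univ (Finset.univ.filter (· ∈ H)))]
    · refine (Finset.sum_bij (fun (h : H) _ => (h : G)) ?_ ?_ ?_ ?_).symm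
      · simp
      · intro a _ b _ hab; exact Subtype.ext hab
      · intro b hb; exact ⟨⟨b, by simpa using hb⟩, by simp, rfl⟩
      · intro a _; simp
    · intro g _ hg
      rw [dif_neg (by simpa using hg)]
  have hG : (Nat.card G : ℂ) ≠ 0 := by simp
  simp only [cfInner, inducedFun]
  simp only [mul_assoc (Nat.card H : ℂ)⁻¹, ← Finset.mul_sum]
  simp only [Finset.sum_mul]
  rw [Finset.sum_comm, Finset.sum_congr rfl fun x _ => key x]
  simp only [Finset.sum_const, Finset.card_univ, nsmul_eq_mul, ← Nat.card_eq_fintype_card]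
  rw [mul_left_comm, inv_mul_cancel_left₀ hG]
  simp

variable {H}

/-- If `H` meets its other conjugates trivially, inducing a class function that vanishes at the
identity does not change its values on `H`. -/
theorem inducedFun_coe (hH : ∀ x : G, x ∉ H → ∀ h ∈ H, x * h * x⁻¹ ∈ H → h = 1) (φ : H → ℂ)
    (hφ : ∀ g x, φ (x * g * x⁻¹) = φ g) (h1 : φ 1 = 0) (y : H) : inducedFun H φ y = φ y := by
  classical
  have key : ∀ x : G, (if h : x⁻¹ * y * x ∈ H then φ ⟨_, h⟩ else 0) = if x ∈ H then φ y else 0 := by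
    intro x
    by_cases hx : x ∈ H
    · rw [if_pos hx, dif_pos (H.mul_mem (H.mul_mem (H.inv_mem hx) y.2) hx), ← hφ y ⟨x, hx⟩⁻¹]
      congr 1
      ext
      simp
    · rw [if_neg hx]
      split_ifs with h
      · have hy : (y : G) = 1 := hH x⁻¹ (by simpa using hx) y y.2 (by simpa using h)
        rw [← h1]
        congr 1
        ext
        simp [hy]
      · rfl
  have hc : (Nat.card H : ℂ) ≠ 0 := by simp
  rw [inducedFun, Finset.sum_congr rfl fun x _ => key x, ← Finset.sum_filter, Finset.sum_const,
    nsmul_eq_mul, ← Fintype.card_subtype, ← Nat.card_eq_fintype_card]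
  exact inv_mul_cancel_left₀ hc _

/-- Over a group `G` with a malnormal subgroup `H`, every irreducible character `θ` of `H` extends
to a representation of `G` that is trivial on the elements with no conjugate in `H`. The extension
is the norm one virtual character `Ind(θ - θ(1)) + θ(1)`. -/
theorem exists_rep_extending [Fintype H]
    (hH : ∀ x : G, x ∉ H → ∀ h ∈ H, x * h * x⁻¹ ∈ H → h = 1)
    {m : ℕ} {d : Fin m → ℕ} [∀ i, NeZero (d i)]
    (e : MonoidAlgebra ℂ H ≃ₐ[ℂ] Π i, Matrix (Fin (d i)) (Fin (d i)) ℂ) (j : Fin m) :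
    ∃ (n : ℕ) (ρ : G →* Matrix (Fin n) (Fin n) ℂ), (∀ h : H, (ρ h).trace = blockChar e j h) ∧
      ∀ g, (∀ x, x * g * x⁻¹ ∉ H) → ρ g = 1 := by
  obtain ⟨m', d', _, ⟨e'⟩⟩ :=
    IsSemisimpleRing.exists_algEquiv_pi_matrix_of_isAlgClosed ℂ (MonoidAlgebra ℂ G)
  have hconj : ∀ g x : H, blockChar e j (x * g * x⁻¹) = blockChar e j g := fun g x => by
    rw [blockChar_mul_comm, inv_mul_cancel_left]
  let φ : H → ℂ := blockChar e j + (-(d j : ℂ)) • 1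
  have hφ : ∀ g x, φ (x * g * x⁻¹) = φ g := fun g x => by simp [φ, hconj]
  have hφ1 : φ 1 = 0 := by simp [φ, blockChar_one]
  let ψ : G → ℂ := inducedFun H φ + (d j : ℂ) • 1
  have hψ : ∀ g x, ψ (x * g * x⁻¹) = ψ g := fun g x => by simp [ψ, inducedFun_conj]
  have hψH : ∀ h : H, ψ h = blockChar e j h := fun h => by
    change inducedFun H φ h + (d j : ℂ) • 1 = _
    rw [inducedFun_coe hH φ hφ hφ1]
    simp [φ]
  have hψ1 : ψ 1 = d j := by rw [← OneMemClass.coe_one H, hψH, blockChar_one]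
  have hint : ∀ i, ∃ z : ℤ, cfInner ψ (blockChar e' i) = z := by
    intro i
    rw [cfInner_add_left, cfInner_smul_left, cfInner_inducedFun H φ _ fun g x => by
      rw [blockChar_mul_comm, inv_mul_cancel_left], cfInner_add_left, cfInner_smul_left]
    have h1 : (1 : H → ℂ) = (Representation.trivial ℂ H ℂ).character := by
      ext; simp [Representation.character]
    have h2 : (1 : G → ℂ) = (Representation.trivial ℂ G ℂ).character := by
      ext; simp [Representation.character]
    have h3 : (fun h : H => blockChar e' i h) =
        Representation.character ((blockRep e' i).comp H.subtype) := by
      rw [← character_blockRep]; rfl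
    obtain ⟨a, ha⟩ := exists_int_cfInner_character (blockRep e j) ((blockRep e' i).comp H.subtype)
    obtain ⟨b, hb⟩ := exists_int_cfInner_character (Representation.trivial ℂ H ℂ)
      ((blockRep e' i).comp H.subtype)
    obtain ⟨c, hc⟩ := exists_int_cfInner_character (Representation.trivial ℂ G ℂ) (blockRep e' i)
    rw [h1, h2, h3, ← character_blockRep e j, ha, hb, ← character_blockRep e' i, hc]
    exact ⟨a + -(d j) * b + d j * c, by push_cast; ring⟩
  have hnorm : cfInner ψ ψ = 1 := by
    have hr : (fun h : H => ψ h) = blockChar e j := funext hψH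
    have h1 : cfInner 1 ψ = cfInner (1 : H → ℂ) (blockChar e j) := by
      rw [cfInner_comm, cfInner_add_left, cfInner_smul_left, cfInner_one_one,
        cfInner_inducedFun H φ 1 (by simp)]
      change cfInner φ 1 + _ = _
      rw [cfInner_add_left, cfInner_smul_left, cfInner_one_one, cfInner_comm]
      ring
    conv_lhs => enter [1]; change inducedFun H φ + (d j : ℂ) • 1
    rw [cfInner_add_left, cfInner_smul_left, h1, cfInner_inducedFun H φ ψ hψ, hr,
      cfInner_add_left, cfInner_smul_left, cfInner_blockChar_self]
    ring
  obtain ⟨i, hi⟩ := exists_eq_blockChar e' ψ hψ hint hnorm hψ1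
  have hd : (d' i : ℂ) = d j := by rw [← hψ1, hi, blockChar_one]
  refine ⟨d' i, ((Pi.evalMonoidHom (fun i => Matrix (Fin (d' i)) (Fin (d' i)) ℂ) i).comp
      ((e' : _ →* _).comp (MonoidAlgebra.of ℂ G))), fun h => ?_, fun g hg => ?_⟩
  · rw [← hψH, hi]; rfl
  · refine matrix_eq_one_of_trace_eq (m := Fintype.card G) Fintype.card_ne_zero _ ?_ ?_
    · rw [← map_pow, pow_card_eq_one, map_one]
    · change blockChar e' i g = _
      rw [← hi, hd]
      simp [ψ, inducedFun_eq_zero H φ g hg]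

/-- **Frobenius's theorem**: if a subgroup `H` of a finite group meets its other conjugates
trivially, then the identity together with the elements that have no conjugate in `H` form a normal
subgroup, the Frobenius kernel. -/
theorem exists_frobenius_kernel (hH : ∀ x : G, x ∉ H → ∀ h ∈ H, x * h * x⁻¹ ∈ H → h = 1) :
    ∃ N : Subgroup G, N.Normal ∧ ∀ g, g ∈ N ↔ g = 1 ∨ ∀ x, x * g * x⁻¹ ∉ H := by
  classical
  -- The kernel is the intersection of the kernels of the extensions of all irreducible
  -- representations of `H`.
  obtain ⟨m, d, _, ⟨e⟩⟩ :=
    IsSemisimpleRing.exists_algEquiv_pi_matrix_of_isAlgClosed ℂ (MonoidAlgebra ℂ H)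
  choose n ρ hρ hker using exists_rep_extending hH e
  have hN : (⨅ j, (ρ j).ker).Normal := Subgroup.normal_iInf_normal fun j => inferInstance
  refine ⟨⨅ j, (ρ j).ker, hN, fun g => ⟨fun hg => ?_, ?_⟩⟩
  · by_contra! hne
    obtain ⟨h1, x, hx⟩ := hne
    -- A nontrivial element of `H` is detected by the regular character of `H`.
    have hmem := hN.conj_mem g hg x
    have hval : ∀ j, blockChar e j ⟨_, hx⟩ = d j := by
      intro j
      have := (Subgroup.mem_iInf.1 hmem) j
      rw [MonoidHom.mem_ker] at this
      rw [← hρ, this, ← blockChar_one e, ← hρ]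
      simp
    have h2 := sum_mul_blockChar e ⟨_, hx⟩
    have h3 := sum_mul_blockChar e 1
    simp only [hval, blockChar_one] at h2 h3
    rw [h3, if_pos trivial] at h2
    split_ifs at h2 with h4
    · apply h1
      have := congrArg Subtype.val h4
      simpa using this
    · simp at h2
  · rintro (rfl | hg)
    · exact Subgroup.one_mem _
    · exact Subgroup.mem_iInf.2 fun j => hker j g hg

end FrobeniusKernel

/-! ### Functions on a Frobenius group and cosets of its kernel -/

section Kernel

variable {n : ℕ} {G : Subgroup (Equiv.Perm (Fin n))}

/-- A nontrivial element of a Frobenius group has at most one fixed point. -/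
theorem IsFrobeniusGroup.eq_one_of_two_fixed (hG : IsFrobeniusGroup G) {g : Equiv.Perm (Fin n)}
    (hg : g ∈ G) {i j : Fin n} (hij : i ≠ j) (hi : g i = i) (hj : g j = j) : g = 1 := by
  obtain ⟨H, -, -, hmal, htrans, i₀, hstab⟩ := hG
  obtain ⟨a, ha, rfl⟩ := htrans i₀ i
  obtain ⟨b, hb, rfl⟩ := htrans i₀ j
  have hconj : ∀ a ∈ G, g (a i₀) = a i₀ → a⁻¹ * g * a ∈ H := fun a ha h => by
    rw [hstab _ (G.mul_mem (G.mul_mem (G.inv_mem ha) hg) ha)]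
    simp [h]
  have h1 := hmal (b⁻¹ * a) (G.mul_mem (G.inv_mem hb) ha) (fun h => hij <| by
    rw [hstab _ (G.mul_mem (G.inv_mem hb) ha)] at h
    simpa [Equiv.symm_apply_eq] using h) _ (hconj a ha hi) (by
    have := hconj b hb hj
    have e : b⁻¹ * a * (a⁻¹ * g * a) * (b⁻¹ * a)⁻¹ = b⁻¹ * g * b := by group
    rwa [e])
  have : a⁻¹ * g * a⁻¹⁻¹ = 1 := by simpa using h1
  exact conj_eq_one_iff.1 this

/-- A subgroup `N` of `G` plays the role of the Frobenius kernel of `G ≤ Sₙ` when it is sharply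
transitive on the points and every element of `G` outside `N` fixes exactly one point. -/
structure IsSharpKernel (N : Subgroup G) : Prop where
  bijective : ∀ i : Fin n, Function.Bijective fun k : N => (k : Equiv.Perm (Fin n)) i
  existsUnique : ∀ g : G, g ∉ N → ∃! i : Fin n, (g : Equiv.Perm (Fin n)) i = i

/-- The Frobenius kernel acts freely, being the identity together with the fixed-point-free
elements. It is transitive because it has `n` elements, by Burnside's lemma. -/
theorem IsFrobeniusGroup.exists_isSharpKernel (hG : IsFrobeniusGroup G) :
    ∃ N : Subgroup G, IsSharpKernel N := by
  classical
  have h2 := fun g hg i j => hG.eq_one_of_two_fixed (g := g) hg (i := i) (j := j)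
  obtain ⟨H, -, -, hmal, htrans, i₀, hstab⟩ := hG
  obtain ⟨N, -, hN⟩ := exists_frobenius_kernel (H := H.subgroupOf G) (by
    intro x hx h hh hc
    ext1
    exact hmal x x.2 (by simpa [Subgroup.mem_subgroupOf] using hx) h
      (by simpa [Subgroup.mem_subgroupOf] using hh)
      (by simpa [Subgroup.mem_subgroupOf] using hc))
  have hfree : ∀ g : G, (∀ x, x * g * x⁻¹ ∉ H.subgroupOf G) ↔
      ∀ i, (g : Equiv.Perm (Fin n)) i ≠ i := by
    intro g
    constructor
    · intro h i hi
      obtain ⟨a, ha, rfl⟩ := htrans i₀ i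
      refine h (⟨a, ha⟩⁻¹) ?_
      rw [Subgroup.mem_subgroupOf, hstab _ (SetLike.coe_mem _)]
      simp [hi]
    · intro h x hx
      rw [Subgroup.mem_subgroupOf, hstab _ (SetLike.coe_mem _)] at hx
      refine h ((x : Equiv.Perm (Fin n))⁻¹ i₀) ?_
      simpa [Equiv.eq_symm_apply] using hx
  simp only [hfree] at hN
  have huniq : ∀ g : G, g ∉ N → ∃! i : Fin n, (g : Equiv.Perm (Fin n)) i = i := by
    intro g hg
    rw [hN] at hg
    push Not at hg
    obtain ⟨h1, i, hi⟩ := hg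
    refine ⟨i, hi, fun j hj => ?_⟩
    by_contra hne
    exact h1 (Subtype.ext (h2 g g.2 j i hne hj hi))
  have hinj : ∀ i : Fin n, Function.Injective fun k : N => (k : Equiv.Perm (Fin n)) i := by
    intro i k l hkl
    have hmem := (hN (l⁻¹ * k : N)).1 (SetLike.coe_mem _)
    rcases hmem with h | h
    · have : l⁻¹ * k = 1 := Subtype.ext h
      exact (inv_mul_eq_one.1 this).symm
    · refine absurd ?_ (h i)
      simp only at hkl
      simp [hkl]
  -- By Burnside's lemma the fixed points of all elements number `|G|`. The identity contributes
  -- `n` of them, and each of the `|G| - |N|` elements outside `N` contributes one.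
  have hcard : Fintype.card N = n := by
    have hb := MulAction.sum_card_fixedBy_eq_card_orbits_mul_card_group G (Fin n)
    have hpre : MulAction.IsPretransitive G (Fin n) := ⟨fun i j => by
      obtain ⟨g, hg, h⟩ := htrans i j
      exact ⟨⟨g, hg⟩, h⟩⟩
    have horb : Fintype.card (Quotient (MulAction.orbitRel G (Fin n))) = 1 := by
      have : Nonempty (Fin n) := ⟨i₀⟩
      rw [Fintype.card_eq_one_iff_nonempty_unique]
      exact (MulAction.pretransitive_iff_unique_quotient_of_nonempty G (Fin n)).1 hpre
    have hfix : ∀ g : G, Fintype.card (MulAction.fixedBy (Fin n) g) =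
        (if g = 1 then n else 0) + if g ∈ N then 0 else 1 := by
      intro g
      by_cases hg1 : g = 1
      · subst hg1
        simp
      · by_cases hg : g ∈ N
        · have := (hN g).1 hg
          simp only [hg1, false_or, if_false, if_pos hg, add_zero] at this ⊢
          rw [Fintype.card_eq_zero_iff]
          exact ⟨fun i => this i i.2⟩
        · obtain ⟨i, hi, hi'⟩ := huniq g hg
          simp only [hg1, if_false, hg, zero_add]
          rw [Fintype.card_eq_one_iff]
          exact ⟨⟨i, hi⟩, fun j => Subtype.ext (hi' j j.2)⟩
    rw [horb, one_mul, Finset.sum_congr rfl fun g _ => hfix g, Finset.sum_add_distrib] at hb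
    have h3 : (∑ g : G, if g ∈ N then 0 else 1) + Fintype.card N = Fintype.card G := by
      rw [Fintype.card_subtype, Finset.card_filter, ← Finset.sum_add_distrib, ← Finset.card_univ,
        Finset.card_eq_sum_ones]
      refine Finset.sum_congr rfl fun g _ => ?_
      split_ifs <;> rfl
    simp only [Finset.sum_ite_eq', Finset.mem_univ, if_true] at hb
    omega
  exact ⟨N, fun i => (Fintype.bijective_iff_injective_and_card _).2 ⟨hinj i, by simp [hcard]⟩,
    huniq⟩

variable {N : Subgroup G}

open Classical in
/-- The number of fixed points of an element, in the presence of a sharply transitive kernel. -/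
theorem IsSharpKernel.card_fixed (hN : IsSharpKernel N) (g : G) :
    (∑ i : Fin n, if (g : Equiv.Perm (Fin n)) i = i then (1 : ℝ) else 0) =
      n * (if g = 1 then 1 else 0) + (1 - if g ∈ N then 1 else 0) := by
  by_cases hg : g ∈ N
  · by_cases h1 : g = 1
    · subst h1; simp
    · rw [Finset.sum_eq_zero]
      · simp [h1, hg]
      · intro i _
        rw [if_neg]
        intro hi
        apply h1
        have := (hN.bijective i).injective (a₁ := ⟨g, hg⟩) (a₂ := 1) (by simpa using hi)
        exact congrArg Subtype.val this
  · obtain ⟨i, hi, hi'⟩ := hN.existsUnique g hg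
    have h1 : g ≠ 1 := fun h => hg (h ▸ N.one_mem)
    rw [Finset.sum_eq_single i]
    · simp [hg, h1, hi]
    · intro j _ hj
      rw [if_neg fun h => hj (hi' j h)]
    · simp

/-- Along each coset of the kernel, the permutation matrices add up to the all-ones matrix. -/
theorem IsSharpKernel.coset_sum (hN : IsSharpKernel N) (c : Fin n → Fin n → ℝ) [Fintype N] (g : G) :
    ∑ k : N, ∑ i, c i (((g * k : G) : Equiv.Perm (Fin n)) i) = ∑ i, ∑ j, c i j := by
  rw [Finset.sum_comm]
  refine Finset.sum_congr rfl fun i _ => ?_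
  exact Function.Bijective.sum_comp ((g : Equiv.Perm (Fin n)).bijective.comp (hN.bijective i))
    fun j => c i j

/-- The linear relations of `coset_sum` are the only ones: a function on `G` whose sums over the
cosets of the kernel agree is the restriction of a linear function on matrices. -/
theorem IsSharpKernel.exists_linear (hN : IsSharpKernel N) (hn : n ≠ 0) [Fintype N] (f : G → ℝ)
    (s : ℝ) (hf : ∀ g : G, ∑ k : N, f (g * k) = s) :
    ∃ c : Fin n → Fin n → ℝ, ∀ g : G, f g = ∑ i, c i ((g : Equiv.Perm (Fin n)) i) := by
  classical
  have hn' : (n : ℝ) ≠ 0 := by exact_mod_cast hn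
  -- Summing `f x` over `x i = g i` and then over `i` weights `f x` by the number of fixed points of
  -- `g⁻¹ * x`, which gives `n * f g + ∑ x, f x - s`; the second term of `c` removes the constant.
  refine ⟨fun i j => (n : ℝ)⁻¹ * (∑ x : G, if (x : Equiv.Perm (Fin n)) i = j then f x else 0) -
    (n : ℝ)⁻¹ * ((n : ℝ)⁻¹ * (∑ x, f x - s)), fun g => ?_⟩
  have h1 : ∀ x : G, (∑ i, if (x : Equiv.Perm (Fin n)) i = (g : Equiv.Perm (Fin n)) i
      then f x else 0) = f x * (n * (if g = x then 1 else 0) + (1 - if g⁻¹ * x ∈ N then 1 else 0)) := by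
    intro x
    have : g = x ↔ g⁻¹ * x = 1 := by rw [inv_mul_eq_one]
    simp only [this]
    rw [← hN.card_fixed, Finset.mul_sum]
    refine Finset.sum_congr rfl fun i _ => ?_
    simp [Equiv.symm_apply_eq]
  have h2 : ∑ x : G, f x * (if g⁻¹ * x ∈ N then (1 : ℝ) else 0) = s := by
    rw [← hf g, ← Equiv.sum_comp (Equiv.mulLeft g)]
    simp only [Equiv.coe_mulLeft, inv_mul_cancel_left, mul_ite, mul_one, mul_zero]
    rw [← Finset.sum_filter]
    exact Finset.sum_subtype _ (by simp) fun x => f (g * x)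
  rw [Finset.sum_sub_distrib, ← Finset.mul_sum, Finset.sum_comm,
    Finset.sum_congr rfl fun x _ => h1 x]
  simp only [mul_add, mul_sub, Finset.sum_add_distrib, Finset.sum_sub_distrib, h2]
  simp
  field_simp
  ring

/-- A nonnegative function on `G` with equal sums over the cosets of `N` is a nonnegative
combination of indicators of transversals of these cosets. A transversal is encoded by its
`N`-components `T` relative to the representatives `Quotient.out`; its weight is the product of the
values of `f` along it, divided by `s ^ (number of cosets - 1)`. -/
theorem exists_transversal_decomposition [Fintype N] (f : G → ℝ) (hf0 : ∀ g, 0 ≤ f g) (s : ℝ)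
    (hf : ∀ g : G, ∑ k : N, f (g * k) = s) :
    ∃ (ι : Type) (_ : Fintype ι) (w : ι → ℝ) (u : ι → G → ℝ), (∀ T, 0 ≤ w T) ∧
      (∀ T g, u T g = 0 ∨ u T g = 1) ∧ (∀ T g, ∑ k : N, u T (g * k) = 1) ∧
      ∀ g, f g = ∑ T, w T * u T g := by
  classical
  let Q := G ⧸ N
  let u : (Q → N) → G → ℝ := fun T g => if (g : Q).out * T (g : Q) = g then 1 else 0
  have hu : ∀ T g, ∑ k : N, u T (g * k) = 1 := by
    intro T g
    have hq : ∀ k : N, ((g * k : G) : Q) = (g : Q) := fun k =>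
      QuotientGroup.mk_mul_of_mem g k.2
    simp only [u, hq]
    have hm : g⁻¹ * ((g : Q).out * T g) ∈ N := by
      rw [← mul_assoc]
      refine N.mul_mem ?_ (SetLike.coe_mem _)
      rw [← QuotientGroup.eq]
      simp
    rw [Finset.sum_eq_single ⟨_, hm⟩]
    · simp
    · intro k _ hk
      rw [if_neg]
      intro h
      apply hk
      ext1
      simp [h]
    · simp
  rcases eq_or_ne s 0 with hs | hs
  · refine ⟨PEmpty, inferInstance, PEmpty.elim, PEmpty.elim, by simp, by simp, by simp, fun g => ?_⟩
    rw [hs] at hf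
    have := (Finset.sum_eq_zero_iff_of_nonneg fun k _ => hf0 _).1 (hf g) 1 (Finset.mem_univ _)
    simpa using this
  · have hs0 : 0 ≤ s := hf 1 ▸ Finset.sum_nonneg fun k _ => hf0 _
    refine ⟨Q → N, inferInstance,
      fun T => (∏ q, f (q.out * T q)) / s ^ (Fintype.card Q - 1), u, fun T => ?_, fun T g => ?_, hu,
      fun g => ?_⟩
    · exact div_nonneg (Finset.prod_nonneg fun q _ => hf0 _) (pow_nonneg hs0 _)
    · simp only [u]; split_ifs <;> simp
    · -- The indicator distributes over the product, as a condition on the factor at the coset of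
      -- `g`; expanding a product of sums then evaluates the sum over all transversals.
      have h1 : ∀ T : Q → N, (∏ q, f (q.out * T q)) * u T g =
          ∏ q, f (q.out * T q) * if q = g → q.out * T q = g then 1 else 0 := by
        intro T
        rw [Finset.prod_mul_distrib]
        congr 1
        rw [← Finset.mul_prod_erase _ _ (Finset.mem_univ (g : Q)), Finset.prod_eq_one]
        · simp [u]
        · intro q hq
          simp [(Finset.mem_erase.1 hq).1]
      have h2 : ∑ T : Q → N, (∏ q, f (q.out * T q)) * u T g = f g * s ^ (Fintype.card Q - 1) := by
        simp only [h1]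
        rw [← Fintype.piFinset_univ, ← Finset.prod_univ_sum (fun _ : Q => (Finset.univ : Finset N))
          fun q k => f (q.out * k) * if q = g → q.out * k = g then 1 else 0,
          ← Finset.mul_prod_erase _ _ (Finset.mem_univ (g : Q))]
        congr 1
        · have hm : (g : Q).out⁻¹ * g ∈ N := by
            rw [← QuotientGroup.eq]; simp
          rw [Finset.sum_eq_single ⟨_, hm⟩]
          · simp
          · intro k _ hk
            rw [if_neg, mul_zero]
            intro h
            apply hk
            ext1
            rw [eq_inv_mul_iff_mul_eq]
            exact h rfl
          · simp
        · rw [Finset.prod_congr rfl (g := fun _ => s)]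
          · simp [Finset.card_erase_of_mem, Q]
          · intro q hq
            simp [(Finset.mem_erase.1 hq).1, hf]
      simp only [div_mul_eq_mul_div, ← Finset.sum_div]
      rw [h2, mul_div_cancel_right₀ _ (pow_ne_zero _ hs)]

end Kernel

/-! ### Polytopes with zero-one decompositions -/

section ZeroOneDecomposition

variable {E : Type*} [AddCommGroup E] [Module ℝ E]

/-- The set `V` has the `0/1`-decomposition property: on `V`, each affine function `c - α` that is
nonnegative on `V` is a nonnegative combination of linear functions that only take the values `0`
and `1` on `V`. -/
def HasZeroOneDecomposition (V : Set E) : Prop :=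
  ∀ (c : E →ₗ[ℝ] ℝ) (α : ℝ), (∀ v ∈ V, 0 ≤ c v - α) →
    ∃ (ι : Type) (_ : Fintype ι) (w : ι → ℝ) (u : ι → E →ₗ[ℝ] ℝ), (∀ T, 0 ≤ w T) ∧
      (∀ T, ∀ v ∈ V, u T v = 0 ∨ u T v = 1) ∧ ∀ v ∈ V, c v - α = ∑ T, w T * u T v

/-- A linear functional nonnegative on `V` is nonnegative on the convex hull of `V`. -/
theorem nonneg_of_mem_convexHull {V : Set E} (u : E →ₗ[ℝ] ℝ) (hu : ∀ v ∈ V, 0 ≤ u v) {x : E}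
    (hx : x ∈ convexHull ℝ V) : 0 ≤ u x :=
  convexHull_min (t := {x | 0 ≤ u x}) hu (convex_halfSpace_ge u.isLinear 0) hx

/-- If `c` defines a facet, then a linear functional vanishing on the facet is, up to scaling, the
same function on the polytope as `c - α`. -/
theorem IsFacetDefining.proportional [FiniteDimensional ℝ E] {P : Set E} {c : E →ₗ[ℝ] ℝ} {α : ℝ}
    (hF : IsFacetDefining P c α) (u : E →ₗ[ℝ] ℝ) (hu : ∀ x ∈ P, c x = α → u x = 0) {v₀ v : E}
    (hv₀ : v₀ ∈ P) (hne : c v₀ ≠ α) (hv : v ∈ P) : (c v - α) * u v₀ = u v * (c v₀ - α) := by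
  obtain ⟨-, ⟨p, hpP, hp⟩, hdim⟩ := hF
  set F := {x | x ∈ P ∧ c x = α} with hFdef
  have hker : ∀ f : E →ₗ[ℝ] ℝ, ∀ b, (∀ x ∈ F, f x = b) → vectorSpan ℝ F ≤ LinearMap.ker f := by
    intro f b hf
    rw [vectorSpan_def, Submodule.span_le]
    rintro _ ⟨x, hx, y, hy, rfl⟩
    simp [hf x hx, hf y hy]
  have hWc := hker c α fun x hx => hx.2
  have hWu := hker u 0 fun x hx => hu x hx.1 hx.2
  have hWP : vectorSpan ℝ F ≤ vectorSpan ℝ P := vectorSpan_mono ℝ fun x hx => hx.1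
  have hd : v₀ - p ∈ vectorSpan ℝ P := vsub_mem_vectorSpan ℝ hv₀ hpP
  have hcd : c (v₀ - p) ≠ 0 := by
    rw [map_sub, hp]
    exact sub_ne_zero.2 hne
  have hlt : vectorSpan ℝ F < vectorSpan ℝ F ⊔ ℝ ∙ (v₀ - p) := by
    refine lt_of_le_not_ge le_sup_left fun h => hcd ?_
    exact hWc (h (Submodule.mem_sup_right (Submodule.mem_span_singleton_self _)))
  have hsup : vectorSpan ℝ F ⊔ ℝ ∙ (v₀ - p) = vectorSpan ℝ P := by
    refine Submodule.eq_of_le_of_finrank_le (sup_le hWP ?_) ?_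
    · rwa [Submodule.span_singleton_le_iff_mem]
    · have := Submodule.finrank_lt_finrank_of_lt hlt
      omega
  have hvp : v - p ∈ vectorSpan ℝ F ⊔ ℝ ∙ (v₀ - p) := hsup ▸ vsub_mem_vectorSpan ℝ hv hpP
  obtain ⟨y, hy, z, hz, hyz⟩ := Submodule.mem_sup.1 hvp
  obtain ⟨t, rfl⟩ := Submodule.mem_span_singleton.1 hz
  have h1 := congrArg c hyz
  have h2 := congrArg u hyz
  have hup := hu p hpP hp
  simp only [map_add, map_sub, map_smul, smul_eq_mul, LinearMap.mem_ker.1 (hWc hy),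
    LinearMap.mem_ker.1 (hWu hy), hp, hup, zero_add, sub_zero] at h1 h2
  rw [← h1, ← h2]
  ring

/-- For a facet inequality `c - α ≥ 0`, some `0/1`-valued summand `u` in the decomposition of
`c - α` is nonzero. It vanishes on the facet because all summands are nonnegative, so it is
proportional to `c - α`, which therefore takes just one value off the facet. -/
theorem HasZeroOneDecomposition.isTwoLevel [FiniteDimensional ℝ E] {V : Set E}
    (hV : HasZeroOneDecomposition V) : IsTwoLevel (convexHull ℝ V) := by
  intro c α hF
  obtain ⟨ι, _, w, u, hw, hu, hcu⟩ := hV c α fun v hv => hF.1 v (subset_convexHull ℝ V hv)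
  have hP : ∀ x ∈ convexHull ℝ V, c x - α = ∑ T, w T * u T x := by
    have hconv : Convex ℝ {x | (c - ∑ T, w T • u T) x = α} :=
      convex_hyperplane (c - ∑ T, w T • u T).isLinear α
    intro x hx
    have := convexHull_min (t := {x | (c - ∑ T, w T • u T) x = α}) (fun v hv => by
      have := hcu v hv
      simp only [Set.mem_ofPred_eq, LinearMap.sub_apply, LinearMap.sum_apply, LinearMap.smul_apply,
        smul_eq_mul]
      linarith) hconv hx
    simp only [Set.mem_ofPred_eq, LinearMap.sub_apply, LinearMap.sum_apply, LinearMap.smul_apply,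
      smul_eq_mul] at this
    linarith
  have hu0 : ∀ T, ∀ v ∈ V, 0 ≤ u T v := fun T v hv => by
    rcases hu T v hv with h | h <;> simp [h]
  -- Some vertex lies off the facet, as the facet is not the whole polytope.
  obtain ⟨v₀, hv₀, hne⟩ : ∃ v ∈ V, c v ≠ α := by
    by_contra! h
    have hall : ∀ x ∈ convexHull ℝ V, c x = α := fun x hx =>
      convexHull_min (t := {x | c x = α}) h (convex_hyperplane c.isLinear α) hx
    have hset : {x | x ∈ convexHull ℝ V ∧ c x = α} = convexHull ℝ V :=
      Set.ext fun x => ⟨fun hx => hx.1, fun hx => ⟨hx, hall x hx⟩⟩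
    have := hF.2.2
    rw [hset] at this
    omega
  obtain ⟨T, hT⟩ : ∃ T, w T * u T v₀ ≠ 0 := by
    by_contra! h
    have := hcu v₀ hv₀
    rw [Finset.sum_eq_zero fun T _ => h T] at this
    exact hne (sub_eq_zero.1 this)
  have hwT : w T ≠ 0 := left_ne_zero_of_mul hT
  have huT : u T v₀ = 1 := (hu T v₀ hv₀).resolve_left (right_ne_zero_of_mul hT)
  have hvan : ∀ x ∈ convexHull ℝ V, c x = α → u T x = 0 := by
    intro x hx hxα
    have hsum := hP x hx
    rw [hxα, sub_self, eq_comm, Finset.sum_eq_zero_iff_of_nonneg fun S _ =>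
      mul_nonneg (hw S) (nonneg_of_mem_convexHull (u S) (hu0 S) hx)] at hsum
    exact (mul_eq_zero.1 (hsum T (Finset.mem_univ T))).resolve_left hwT
  refine ⟨c v₀, fun v hv => ?_⟩
  have hvV : v ∈ V := extremePoints_convexHull_subset hv
  have hprop := hF.proportional (u T) hvan (subset_convexHull ℝ V hv₀) hne
    (subset_convexHull ℝ V hvV)
  rw [huT, mul_one] at hprop
  rcases hu T v hvV with h | h
  · left
    rw [h, zero_mul] at hprop
    linarith
  · right
    rw [h, one_mul] at hprop
    linarith

end ZeroOneDecomposition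

section ThetaBody

variable {σ : Type*} [Fintype σ]

open MvPolynomial

/-- A polynomial of degree at most one is an affine function. -/
theorem eval_convexCombination_of_totalDegree_le_one (f : MvPolynomial σ ℝ)
    (hf : f.totalDegree ≤ 1) (x y : σ → ℝ) {a b : ℝ} (hab : a + b = 1) :
    eval (a • x + b • y) f = a * eval x f + b * eval y f := by
  classical
  simp only [eval_eq', Finset.mul_sum, ← Finset.sum_add_distrib]
  refine Finset.sum_congr rfl fun s hs => ?_
  have hdeg : s.degree ≤ 1 := (le_totalDegree hs).trans hf
  rcases Nat.le_one_iff_eq_zero_or_eq_one.1 hdeg with h | h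
  · rw [Finsupp.degree_eq_zero_iff] at h
    subst h
    simp only [Finsupp.coe_zero, Pi.zero_apply, pow_zero, Finset.prod_const_one]
    linear_combination (-(coeff 0 f)) * hab
  · obtain ⟨i, rfl⟩ := (Finsupp.sum_eq_one_iff s).1 h
    have hprod : ∀ z : σ → ℝ, ∏ j, z j ^ (Finsupp.single i 1) j = z i := by
      intro z
      rw [Finset.prod_eq_single i]
      · simp
      · intro j _ hj; simp [Ne.symm hj]
      · simp
    simp only [hprod, Pi.add_apply, Pi.smul_apply, smul_eq_mul]
    ring

/-- The linear polynomial of a linear functional. -/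
noncomputable def linearPoly (c : (σ → ℝ) →ₗ[ℝ] ℝ) : MvPolynomial σ ℝ :=
  by classical exact ∑ i, C (c (Pi.single i 1)) * X i

theorem eval_linearPoly (c : (σ → ℝ) →ₗ[ℝ] ℝ) (x : σ → ℝ) : eval x (linearPoly c) = c x := by
  classical
  conv_rhs => rw [← Finset.univ_sum_single x]
  simp only [linearPoly, map_sum, map_mul, eval_C, eval_X]
  refine Finset.sum_congr rfl fun i _ => ?_
  rw [mul_comm, ← smul_eq_mul, ← map_smul, ← Pi.single_smul, smul_eq_mul, mul_one]

theorem totalDegree_linearPoly_le (c : (σ → ℝ) →ₗ[ℝ] ℝ) : (linearPoly c).totalDegree ≤ 1 := by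
  classical
  refine totalDegree_finsetSum_le fun i _ => (totalDegree_mul _ _).trans ?_
  simp

/-- The convex hull of a set lies in every theta body of its vanishing ideal: a polynomial that is
a sum of squares modulo the ideal is nonnegative on the set. -/
theorem convexHull_subset_thetaBody (k : ℕ) (V : Set (σ → ℝ)) :
    convexHull ℝ V ⊆ thetaBody k (vanishingIdeal ℝ V) := by
  rintro x hx f hf ⟨t, h, -, hmem⟩
  refine convexHull_min (t := {x | 0 ≤ eval x f}) (fun v hv => ?_) ?_ hx
  · have := (mem_vanishingIdeal_iff.1 hmem) v hv
    rw [aeval_eq_eval, map_sub, map_sum, sub_eq_zero] at this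
    rw [Set.mem_ofPred_eq]
    refine this.symm ▸ Finset.sum_nonneg fun j _ => ?_
    rw [map_pow]
    exact sq_nonneg _
  · intro y hy z hz a b ha hb hab
    rw [Set.mem_ofPred_eq, eval_convexCombination_of_totalDegree_le_one f hf y z hab]
    exact add_nonneg (mul_nonneg ha hy) (mul_nonneg hb hz)

/-- If nonnegative affine functions on a finite set `V` decompose into `0/1`-valued linear ones,
then they are sums of squares of linear functions on `V`, because `u = u ^ 2` for `0/1`-valued `u`.
Hence the first theta body is cut out by the half-spaces containing `V`. -/
theorem HasZeroOneDecomposition.thetaBody_one {V : Set (σ → ℝ)} (hV : HasZeroOneDecomposition V)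
    (hfin : V.Finite) : thetaBody 1 (vanishingIdeal ℝ V) = convexHull ℝ V := by
  refine Set.Subset.antisymm (fun x hx => ?_) (convexHull_subset_thetaBody 1 V)
  by_contra hnot
  obtain ⟨c, α, hxα, hα⟩ := geometric_hahn_banach_point_closed (convex_convexHull ℝ V)
    (hfin.isCompact_convexHull ℝ).isClosed hnot
  obtain ⟨ι, _, w, u, hw, hu, hcu⟩ := hV c.toLinearMap α fun v hv =>
    sub_nonneg.2 (hα v (subset_convexHull ℝ V hv)).le
  let ε := Fintype.equivFin ι
  have hsos : IsKSosMod 1 (vanishingIdeal ℝ V) (linearPoly c.toLinearMap - C α) := by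
    refine ⟨Fintype.card ι, fun j => C √(w (ε.symm j)) * linearPoly (u (ε.symm j)), fun j => ?_, ?_⟩
    · refine (totalDegree_mul _ _).trans ?_
      rw [totalDegree_C, zero_add]
      exact totalDegree_linearPoly_le _
    · rw [mem_vanishingIdeal_iff]
      intro v hv
      have hsum := hcu v hv
      rw [← ε.symm.sum_comp] at hsum
      rw [aeval_eq_eval, map_sub, map_sub, eval_C, eval_linearPoly, hsum, map_sum, sub_eq_zero]
      refine Finset.sum_congr rfl fun j _ => ?_
      rw [map_pow, map_mul, eval_C, eval_linearPoly, mul_pow, Real.sq_sqrt (hw _)]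
      rcases hu (ε.symm j) v hv with h | h <;> simp [h]
  have hdeg : (linearPoly c.toLinearMap - C α).totalDegree ≤ 1 :=
    (totalDegree_sub_C_le _ _).trans (totalDegree_linearPoly_le _)
  have := hx _ hdeg hsos
  rw [map_sub, eval_C, eval_linearPoly] at this
  exact absurd hxα (not_lt.2 (sub_nonneg.1 this))

end ThetaBody

/-! ### Permutation matrices -/

section PermutationMatrices

variable {n : ℕ} {G : Subgroup (Equiv.Perm (Fin n))}

/-- The permutation matrices of the elements of `G`. -/
def permMatrices (G : Subgroup (Equiv.Perm (Fin n))) : Set (Matrix (Fin n) (Fin n) ℝ) :=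
  {M | ∃ g ∈ G, M = Matrix.of fun i j => if g i = j then (1 : ℝ) else 0}

theorem finite_permMatrices : (permMatrices G).Finite := by
  refine (Set.finite_range fun g : Equiv.Perm (Fin n) =>
    (Matrix.of fun i j => if g i = j then (1 : ℝ) else 0)).subset ?_
  rintro M ⟨g, -, rfl⟩
  exact ⟨g, rfl⟩

/-- The matrix space as the space of vectors indexed by pairs, via `entries`. -/
def entriesEquiv (n : ℕ) : Matrix (Fin n) (Fin n) ℝ ≃ₗ[ℝ] (Fin n × Fin n → ℝ) where
  toFun := entries
  invFun x := Matrix.of fun i j => x (i, j)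
  map_add' _ _ := rfl
  map_smul' _ _ := rfl
  left_inv _ := rfl
  right_inv _ := rfl

/-- Every permutation matrix in the permutation polytope is a vertex of it, being already a vertex
of the cube of matrices with entries in `[0, 1]`. -/
theorem extremePoints_permutationPolytope :
    (permutationPolytope G).extremePoints ℝ = permMatrices G := by
  refine Set.Subset.antisymm extremePoints_convexHull_subset fun M hM => ?_
  have hcube : ∀ X ∈ permutationPolytope G, ∀ i j, 0 ≤ X i j ∧ X i j ≤ 1 := by
    intro X hX i j
    refine convexHull_min (t := {X : Matrix (Fin n) (Fin n) ℝ | 0 ≤ X i j ∧ X i j ≤ 1}) ?_ ?_ hX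
    · rintro _ ⟨g, -, rfl⟩
      simp only [Set.mem_ofPred_eq, Matrix.of_apply]
      split_ifs <;> norm_num
    · intro X hX Y hY a b ha hb hab
      simp only [Set.mem_ofPred_eq, Matrix.add_apply, Matrix.smul_apply, smul_eq_mul] at *
      constructor <;> nlinarith
  rw [mem_extremePoints_iff_left]
  refine ⟨subset_convexHull ℝ _ hM, fun X hX Y hY hXY => ?_⟩
  obtain ⟨g, -, rfl⟩ := hM
  obtain ⟨a, b, ha, hb, hab, h⟩ := hXY
  ext i j
  have hij := congrFun (congrFun h i) j
  simp only [Matrix.add_apply, Matrix.smul_apply, smul_eq_mul, Matrix.of_apply] at hij ⊢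
  have h1 := hcube X hX i j
  have h2 := hcube Y hY i j
  split_ifs at hij ⊢
  · nlinarith
  · nlinarith

/-- A linear functional evaluated at a permutation matrix. -/
theorem apply_permMatrix (c : Matrix (Fin n) (Fin n) ℝ →ₗ[ℝ] ℝ) (g : Equiv.Perm (Fin n)) :
    c (Matrix.of fun i j => if g i = j then (1 : ℝ) else 0) = ∑ i, c (Matrix.single i (g i) 1) := by
  rw [← map_sum]
  congr 1
  ext i j
  rw [Matrix.sum_apply, Finset.sum_eq_single i]
  · simp [Matrix.single_apply]
  · intro k _ hk
    simp [hk]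
  · simp

/-- An affine functional restricts to a function on `G` with equal coset sums; the transversal
decomposition of that function consists of functions of the same kind, so it can be carried back to
matrices. -/
theorem IsSharpKernel.hasZeroOneDecomposition {N : Subgroup G} (hN : IsSharpKernel N)
    (hn : n ≠ 0) : HasZeroOneDecomposition (permMatrices G) := by
  classical
  intro c α hc
  let f : G → ℝ := fun g => ∑ i, c (Matrix.single i ((g : Equiv.Perm (Fin n)) i) 1) - α
  have hfc : ∀ g : G, f g =
      c (Matrix.of fun i j => if (g : Equiv.Perm (Fin n)) i = j then (1 : ℝ) else 0) - α :=
    fun g => by rw [apply_permMatrix]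
  have hf : ∀ g : G, ∑ k : N, f (g * k) =
      ∑ i, ∑ j, c (Matrix.single i j 1) - Fintype.card N * α := by
    intro g
    simp only [f, Finset.sum_sub_distrib]
    rw [hN.coset_sum (fun i j => c (Matrix.single i j 1))]
    simp
  obtain ⟨ι, _, w, u, hw, hu, hu1, hfu⟩ := exists_transversal_decomposition f
    (fun g => by rw [hfc]; exact hc _ ⟨g, g.2, rfl⟩) _ hf
  choose a ha using fun T => hN.exists_linear hn (u T) 1 (hu1 T)
  let U : ι → Matrix (Fin n) (Fin n) ℝ →ₗ[ℝ] ℝ := fun T =>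
    ∑ i, ∑ j, a T i j • Matrix.entryLinearMap ℝ ℝ i j
  have hU : ∀ T, ∀ g : G,
      U T (Matrix.of fun i j => if (g : Equiv.Perm (Fin n)) i = j then (1 : ℝ) else 0) = u T g := by
    intro T g
    rw [ha]
    simp [U]
  refine ⟨ι, inferInstance, w, U, hw, ?_, ?_⟩
  · rintro T _ ⟨g, hg, rfl⟩
    rw [hU T ⟨g, hg⟩]
    exact hu T _
  · rintro _ ⟨g, hg, rfl⟩
    rw [← hfc ⟨g, hg⟩, hfu]
    exact Finset.sum_congr rfl fun T _ => by rw [← hU T ⟨g, hg⟩]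

theorem HasZeroOneDecomposition.image {E F : Type*} [AddCommGroup E] [Module ℝ E] [AddCommGroup F]
    [Module ℝ F] {V : Set E} (hV : HasZeroOneDecomposition V) (e : E ≃ₗ[ℝ] F) :
    HasZeroOneDecomposition (e '' V) := by
  intro c α hc
  obtain ⟨ι, _, w, u, hw, hu, hcu⟩ := hV (c ∘ₗ e) α fun v hv => hc _ ⟨v, hv, rfl⟩
  refine ⟨ι, inferInstance, w, fun T => u T ∘ₗ e.symm, hw, ?_, ?_⟩
  · rintro T _ ⟨v, hv, rfl⟩
    simpa using hu T v hv
  · rintro _ ⟨v, hv, rfl⟩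
    simpa using hcu v hv

end PermutationMatrices

end PermPolytope


theorem proposition1 (n : ℕ) (G : Subgroup (Equiv.Perm (Fin n)))
    (hG : PermPolytope.IsFrobeniusGroup G) :
    PermPolytope.IsTwoLevel (PermPolytope.permutationPolytope G) ∧ PermPolytope.IsTHExact 1 G := by
  obtain ⟨N, hN⟩ := hG.exists_isSharpKernel
  have hn : n ≠ 0 := by
    obtain ⟨-, -, -, -, -, i, -⟩ := hG
    exact Nat.ne_zero_of_lt i.2
  have hV := hN.hasZeroOneDecomposition hn
  refine ⟨hV.isTwoLevel, ?_⟩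
  have himage : PermPolytope.entries '' PermPolytope.permutationPolytope G =
      convexHull ℝ (PermPolytope.entriesEquiv n '' PermPolytope.permMatrices G) :=
    LinearMap.image_convexHull (PermPolytope.entriesEquiv n).toLinearMap _
  rw [PermPolytope.IsTHExact, PermPolytope.extremePoints_permutationPolytope, himage]
  exact (hV.image (PermPolytope.entriesEquiv n)).thetaBody_one
    (PermPolytope.finite_permMatrices.image _)
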